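/- Let $G$ be a Hausdorff topological group acting continuously on a compact Hausdorff space $X$, and suppose that the action is minimal (every orbit is dense). For $n\ge 1$ let $\mathcal{HK}^{[n]}$ be the subgroup of $G^{\{0,1\}^n}$ generated by the elements $[h]_F$, where $h\in G$, $F=\{\omega\in\{0,1\}^n:\omega_i=a\}$ is a hyperface ($1\le i\le n$, $a\in\{0,1\}$), and $[h]_F(\omega)=h$ for $\omega\in F$, $[h]_F(\omega)=\mathrm{Id}$ otherwise. Put $$C_G^{[n]}(X)=\overline{\{(\gamma(\omega)x)_{\omega\in\{0,1\}^n}:\gamma\in\mathcal{HK}^{[n]},\ x\in X\}}\subseteq X^{\{0,1\}^n}.$$ For $d\ge 1$ let $\mathrm{NRP}^{[d]}(X)$ be the set of pairs $(x,y)\in X\times X$ such that the configuration in $X^{\{0,1\}^{d+1}}$ with value $y$ at $\vec 1=(1,\dots,1)$ and value $x$ at every other vertex belongs to $C_G^{[d+1]}(X)$. A system $(G,Y)$ (a continuous action of $G$ on a compact Hausdorff space $Y$) is called of order at most $d$ if $\mathrm{NRP}^{[d]}(Y)$, defined in the same way, is the diagonal of $Y\times Y$. A factor map is a continuous $G$-equivariant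 surjection between systems. Let $d\ge 1$. Then $\mathrm{NRP}^{[d]}(X)$ is an equivalence relation; the quotient space $X/\mathrm{NRP}^{[d]}(X)$, with the induced action of $G$, is a system (it is compact Hausdorff and the action is well defined and continuous); the quotient map $\pi_d\colon X\to X/\mathrm{NRP}^{[d]}(X)$ is a factor map; and $(G,X/\mathrm{NRP}^{[d]}(X))$ is the maximal factor of $(G,X)$ of order at most $d$, that is: 1. $\mathrm{NRP}^{[d]}\big(X/\mathrm{NRP}^{[d]}(X)\big)$ is the diagonal, so $(G,X/\mathrm{NRP}^{[d]}(X))$ is a system of order at most $d$; 2. if $\phi\colon (G,X)\to(G,Y)$ is a factor map onto a system $(G,Y)$ of order at most $d$, then there is a factor map $\psi\colon (G,X/\mathrm{NRP}^{[d]}(X))\to(G,Y)$ with $\phi=\psi\circ\pi_d$. -/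

import Mathlib

namespace NilRP

/-- The discrete cube `{0,1}ⁿ`; `false` stands for `0` and `true` for `1`. -/
abbrev Cube (n : ℕ) : Type := Fin n → Bool

/-- The hyperface `{ω | ω i = a}` of the discrete cube. -/
def hyperface {n : ℕ} (i : Fin n) (a : Bool) : Set (Cube n) := {ω | ω i = a}

open Classical in
/-- The element `[h]_F` of `G^{[n]}`, equal to `h` on `F` and to the identity off `F`. -/
noncomputable def faceElement {G : Type*} [Group G] {n : ℕ} (F : Set (Cube n)) (h : G) :
    Cube n → G :=
  fun ω => if ω ∈ F then h else 1

/-- The Host–Kra cube group: the subgroup of `G^{[n]}` generated by all `[h]_F`, with `h ∈ G`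
and `F` a hyperface of `{0,1}ⁿ`. -/
def hostKraGroup (G : Type*) [Group G] (n : ℕ) : Subgroup (Cube n → G) :=
  Subgroup.closure {γ | ∃ (i : Fin n) (a : Bool) (h : G), γ = faceElement (hyperface i a) h}

/-- The dynamical cubes: the closure, in the product topology on `X^{[n]}`, of the set of
configurations `γ x^{[n]}` with `γ` in the Host–Kra cube group and `x ∈ X`. -/
def dynamicalCubes (G X : Type*) [Group G] [TopologicalSpace X] [MulAction G X] (n : ℕ) :
    Set (Cube n → X) :=
  closure {c | ∃ γ ∈ hostKraGroup G n, ∃ x : X, c = fun ω => γ ω • x}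

/-- The lower corner: the value is `y` at the vertex `(1, …, 1)` and `x` at all other vertices. -/
def lowerCorner {X : Type*} (n : ℕ) (x y : X) : Cube n → X :=
  fun ω => if ω = (fun _ => true) then y else x

/-- The nilpotent regionally proximal relation of order `d`. -/
def NRP (G X : Type*) [Group G] [TopologicalSpace X] [MulAction G X] (d : ℕ) (x y : X) : Prop :=
  lowerCorner (d + 1) x y ∈ dynamicalCubes G X (d + 1)

/-- `(G, X)` is a system of order at most `d`: the relation `NRP^{[d]}(X)` is the diagonal. -/
def IsOfOrderAtMost (G X : Type*) [Group G] [TopologicalSpace X] [MulAction G X] (d : ℕ) : Prop :=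
  ∀ x y : X, NRP G X d x y ↔ x = y

/-- A factor map: a continuous `G`-equivariant surjection. -/
structure IsFactorMap (G : Type*) {X Y : Type*} [Group G] [TopologicalSpace X] [MulAction G X]
    [TopologicalSpace Y] [MulAction G Y] (f : X → Y) : Prop where
  continuous : Continuous f
  map_smul : ∀ (g : G) (x : X), f (g • x) = g • f x
  surjective : Function.Surjective f

/-- The constant elements `g^{[n]}`, `n ≥ 1`, lie in the Host–Kra cube group. -/
theorem const_mem_hostKraGroup {G : Type*} [Group G] (n : ℕ) (g : G) :
    (fun _ => g) ∈ hostKraGroup G (n + 1) := by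
  have h : (fun _ => g : Cube (n + 1) → G)
      = faceElement (hyperface 0 false) g * faceElement (hyperface 0 true) g := by
    funext ω
    cases hω : ω 0 <;> simp [faceElement, hyperface, hω]
  rw [h]
  exact mul_mem (Subgroup.subset_closure ⟨0, false, g, rfl⟩)
    (Subgroup.subset_closure ⟨0, true, g, rfl⟩)

/-- The relation `NRP^{[d]}(X)` is `G`-invariant. -/
theorem NRP.smul {G X : Type*} [Group G] [TopologicalSpace X] [MulAction G X]
    [ContinuousConstSMul G X] {d : ℕ} {x y : X} (h : NRP G X d x y) (g : G) :
    NRP G X d (g • x) (g • y) := by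
  have hcont : Continuous fun c : Cube (d + 1) → X => fun ω => g • c ω := by fun_prop
  have hmaps : Set.MapsTo (fun c : Cube (d + 1) → X => fun ω => g • c ω)
      {c | ∃ γ ∈ hostKraGroup G (d + 1), ∃ x : X, c = fun ω => γ ω • x}
      {c | ∃ γ ∈ hostKraGroup G (d + 1), ∃ x : X, c = fun ω => γ ω • x} := by
    rintro c ⟨γ, hγ, z, rfl⟩
    exact ⟨(fun _ => g) * γ, mul_mem (const_mem_hostKraGroup d g) hγ, z, by
      funext ω
      simp [mul_smul]⟩
  have key := hmaps.closure hcont h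
  have hcorner : lowerCorner (d + 1) (g • x) (g • y)
      = fun ω => g • lowerCorner (d + 1) x y ω := by
    funext ω
    simp only [lowerCorner]
    split_ifs <;> rfl
  unfold NRP
  rw [hcorner]
  exact key

section Quotient

variable {G X : Type*} [Group G] [TopologicalSpace X] [MulAction G X] {d : ℕ}

/-- The quotient space `X / NRP^{[d]}(X)`, available once `NRP^{[d]}(X)` is known to be an
equivalence relation. -/
def NRPQuotient (h : Equivalence (NRP G X d)) : Type _ := Quotient (Setoid.mk (NRP G X d) h)

/-- The quotient map `π_d : X → X / NRP^{[d]}(X)`. -/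
def NRPQuotient.mk (h : Equivalence (NRP G X d)) (x : X) : NRPQuotient h :=
  Quotient.mk (Setoid.mk (NRP G X d) h) x

/-- The quotient topology. -/
instance (h : Equivalence (NRP G X d)) : TopologicalSpace (NRPQuotient h) :=
  inferInstanceAs (TopologicalSpace (Quotient (Setoid.mk (NRP G X d) h)))

/-- The induced action, `g • π_d x = π_d (g • x)`. -/
instance [ContinuousConstSMul G X] (h : Equivalence (NRP G X d)) :
    MulAction G (NRPQuotient h) where
  smul g := Quotient.map (g • ·) fun _ _ hxy => NRP.smul hxy g
  one_smul := by
    rintro ⟨x⟩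
    exact congrArg (NRPQuotient.mk h) (one_smul G x)
  mul_smul := by
    rintro a b ⟨x⟩
    exact congrArg (NRPQuotient.mk h) (mul_smul a b x)

end Quotient

end NilRP

/-! The argument lives in enveloping semigroups. Fix a minimal left ideal I of the enveloping
semigroup of (G, X). By minimality each point is fixed by some idempotent w of I, and every
dynamical cube is the image of any given constant cube under an element t of the enveloping
semigroup of the Host–Kra group.

The elements wtw are invertible relative to w (`IsMinimalLeftIdeal.exists_inverse`). Hence a cube of
w-fixed points can be pulled back to a constant cube, altered at one vertex and pushed forward
again: this replaces a vertex value by an NRP-related w-fixed point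
(`IsMinimalLeftIdeal.update_mem_dynamicalCubes`). The restriction to w-fixed points is removed by
`IsMinimalLeftIdeal.nrp_of_idempotent_apply`.

Symmetry follows by replacing all vertices but one. Transitivity follows from
`IsMinimalLeftIdeal.nrp_of_mem_dynamicalCubes`; since cubes lift through factor maps, so does the
triviality of NRP on the quotient. Maximality holds because factor maps preserve NRP. -/

namespace NilRP

open Set Function

section Ellis

/-! ### Compact right topological semigroups -/

variable {M : Type*} [Monoid M] [TopologicalSpace M]

/-- The closure of a subsemigroup consisting of elements with continuous left multiplication
is a subsemigroup. -/
theorem mul_mem_closure_of_continuous {S : Set M} (hS : ∀ a ∈ S, ∀ b ∈ S, a * b ∈ S)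
    (hr : ∀ r : M, Continuous (· * r)) (hl : ∀ a ∈ S, Continuous (a * ·)) {a b : M}
    (ha : a ∈ closure S) (hb : b ∈ closure S) : a * b ∈ closure S := by
  -- Multiplication is only separately continuous here, so the two limits are taken one after the
  -- other.
  have h1 : ∀ a ∈ S, a * b ∈ closure S := fun a ha =>
    MapsTo.closure (fun c hc => hS a ha c hc : MapsTo (a * ·) S S) (hl a ha) hb
  have h2 := MapsTo.closure (fun c hc => h1 c hc : MapsTo (· * b) S (closure S)) (hr b) ha
  rwa [closure_closure] at h2

/-- A minimal closed left ideal of the subsemigroup `E`. -/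
structure IsMinimalLeftIdeal (E I : Set M) : Prop where
  subset : I ⊆ E
  nonempty : I.Nonempty
  isClosed : IsClosed I
  mul_mem : ∀ e ∈ E, ∀ p ∈ I, e * p ∈ I
  eq_of_subset : ∀ J ⊆ I, J.Nonempty → IsClosed J → (∀ e ∈ E, ∀ p ∈ J, e * p ∈ J) → J = I

theorem exists_isMinimalLeftIdeal [CompactSpace M] {E : Set M} (hE : IsClosed E)
    (hne : E.Nonempty) (hmul : ∀ a ∈ E, ∀ b ∈ E, a * b ∈ E) :
    ∃ I, IsMinimalLeftIdeal E I := by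
  obtain ⟨I, hIE, hI⟩ := zorn_superset_nonempty
    {J : Set M | J.Nonempty ∧ IsClosed J ∧ ∀ e ∈ E, ∀ p ∈ J, e * p ∈ J} (fun c hcs hc hcne => by
      refine ⟨⋂₀ c, ⟨?_, isClosed_sInter fun t ht => (hcs ht).2.1, fun e he p hp t ht =>
        (hcs ht).2.2 e he p (hp t ht)⟩, fun s hs => sInter_subset_of_mem hs⟩
      have := hcne.to_subtype
      exact IsCompact.nonempty_sInter_of_directed_nonempty_isCompact_isClosed
        (IsChain.directedOn hc.symm) (fun t ht => (hcs ht).1)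
        (fun t ht => (hcs ht).2.1.isCompact) (fun t ht => (hcs ht).2.1)) E ⟨hne, hE, hmul⟩
  exact ⟨I, hIE, hI.prop.1, hI.prop.2.1, hI.prop.2.2, fun J hJ h1 h2 h3 =>
    hI.eq_of_subset ⟨h1, h2, h3⟩ hJ⟩

/-- Idempotents of a minimal left ideal are right identities for that ideal. -/
theorem IsMinimalLeftIdeal.mul_idempotent [CompactSpace M] [T2Space M] {E I : Set M}
    (hI : IsMinimalLeftIdeal E I) (hE : IsClosed E) (hmul : ∀ a ∈ E, ∀ b ∈ E, a * b ∈ E)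
    (hr : ∀ r : M, Continuous (· * r)) {p v : M} (hp : p ∈ I) (hv : v ∈ I) (hvv : v * v = v) :
    p * v = p := by
  -- Ev is a closed left ideal inside I, so it is all of I and p has the form ev.
  have h : (· * v) '' E = I := hI.eq_of_subset _
    (image_subset_iff.2 fun e he => hI.mul_mem e he v hv)
    (Nonempty.image _ ⟨v, hI.subset hv⟩) (hE.isCompact.image (hr v)).isClosed (by
      rintro e he _ ⟨q, hq, rfl⟩
      exact ⟨e * q, hmul e he q hq, mul_assoc _ _ _⟩)
  obtain ⟨e, -, rfl⟩ := h.symm.subset hp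
  simp only [mul_assoc, hvv]

end Ellis

/-! ### Self-maps under pointwise convergence -/

section EndTopology

variable {X : Type*} [TopologicalSpace X]

/-- The topology of pointwise convergence on the self-maps of `X`. -/
instance : TopologicalSpace (Function.End X) := inferInstanceAs (TopologicalSpace (X → X))

instance [CompactSpace X] : CompactSpace (Function.End X) :=
  inferInstanceAs (CompactSpace (X → X))

instance [T2Space X] : T2Space (Function.End X) := inferInstanceAs (T2Space (X → X))

theorem continuous_end_apply (x : X) : Continuous fun p : Function.End X => p x :=
  continuous_apply (A := fun _ : X => X) x

theorem continuous_end_mul_right (r : Function.End X) : Continuous (· * r) :=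
  continuous_pi (A := fun _ : X => X) fun x => continuous_end_apply (r x)

theorem continuous_end_mul_left {a : Function.End X} (ha : Continuous (a : X → X)) :
    Continuous (a * ·) :=
  continuous_pi (A := fun _ : X => X) fun x => ha.comp (continuous_end_apply x)

theorem continuous_pi_end_mul_right {ι : Type*} (r : ι → Function.End X) :
    Continuous (· * r) :=
  continuous_pi fun i => (continuous_end_mul_right (r i)).comp (continuous_apply i)

end EndTopology

/-! ### Enveloping semigroups -/

variable (G X : Type*) [Group G] [TopologicalSpace X] [MulAction G X]

/-- The enveloping (Ellis) semigroup of `(G, X)`. -/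
def ellis : Set (Function.End X) := closure (range (MulAction.toEndHom : G →* Function.End X))

/-- The enveloping semigroup of the Host–Kra cube group acting on `X^{[n]}`; its elements act
coordinatewise. -/
def cubeEllis (n : ℕ) : Set (Cube n → Function.End X) :=
  closure ((fun γ ω => (MulAction.toEndHom (γ ω) : Function.End X)) ''
    (hostKraGroup G n : Set (Cube n → G)))

variable {G X}

theorem toEndHom_mem_ellis (g : G) : (MulAction.toEndHom g : Function.End X) ∈ ellis G X :=
  subset_closure ⟨g, rfl⟩

theorem toEndHom_mem_cubeEllis {n : ℕ} {γ : Cube n → G} (hγ : γ ∈ hostKraGroup G n) :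
    (fun ω => MulAction.toEndHom (γ ω)) ∈ cubeEllis G X n :=
  subset_closure ⟨γ, hγ, rfl⟩

theorem one_mem_cubeEllis (n : ℕ) : 1 ∈ cubeEllis G X n := by
  have h := toEndHom_mem_cubeEllis (X := X) (one_mem (hostKraGroup G n))
  simp only [Pi.one_apply, map_one] at h
  exact h

theorem apply_mem_ellis {n : ℕ} {φ : Cube n → Function.End X} (hφ : φ ∈ cubeEllis G X n)
    (ω : Cube n) : φ ω ∈ ellis G X := by
  refine MapsTo.closure ?_ (continuous_apply ω) hφ
  rintro _ ⟨γ, -, rfl⟩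
  exact ⟨γ ω, rfl⟩

/-- The enveloping semigroup of a hyperface subgroup. -/
theorem hyperface_mem_cubeEllis {n : ℕ} (i : Fin n) {p : Function.End X} (hp : p ∈ ellis G X) :
    (fun ω => if ω i = false then p else 1) ∈ cubeEllis G X n := by
  refine MapsTo.closure (f := fun (p : Function.End X) (ω : Cube n) =>
    if ω i = false then p else 1) ?_ ?_ hp
  · rintro _ ⟨g, rfl⟩
    refine ⟨faceElement (hyperface i false) g, Subgroup.subset_closure ⟨i, false, g, rfl⟩, ?_⟩
    funext ω
    by_cases h : ω i = false <;> simp [faceElement, hyperface, h]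
  · refine continuous_pi fun ω => ?_
    split_ifs
    exacts [continuous_id, continuous_const]

theorem const_mem_cubeEllis {n : ℕ} {p : Function.End X} (hp : p ∈ ellis G X) :
    (fun _ => p) ∈ cubeEllis G X (n + 1) := by
  refine MapsTo.closure (f := fun (p : Function.End X) (_ : Cube (n + 1)) => p) ?_
    (continuous_pi fun _ => continuous_id) hp
  rintro _ ⟨g, rfl⟩
  exact ⟨fun _ => g, const_mem_hostKraGroup n g, rfl⟩

/-! ### Composition in the enveloping semigroups and their action on cubes -/

section Mul

variable [ContinuousConstSMul G X]

theorem mul_mem_ellis {p q : Function.End X} (hp : p ∈ ellis G X) (hq : q ∈ ellis G X) :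
    p * q ∈ ellis G X := by
  refine mul_mem_closure_of_continuous ?_ continuous_end_mul_right ?_ hp hq
  · rintro _ ⟨g, rfl⟩ _ ⟨h, rfl⟩
    exact ⟨g * h, map_mul _ _ _⟩
  · rintro _ ⟨g, rfl⟩
    exact continuous_end_mul_left (continuous_const_smul g)

theorem mul_mem_cubeEllis {n : ℕ} {p q : Cube n → Function.End X} (hp : p ∈ cubeEllis G X n)
    (hq : q ∈ cubeEllis G X n) : p * q ∈ cubeEllis G X n := by
  refine mul_mem_closure_of_continuous ?_ continuous_pi_end_mul_right ?_ hp hq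
  · rintro _ ⟨γ, hγ, rfl⟩ _ ⟨δ, hδ, rfl⟩
    exact ⟨γ * δ, mul_mem hγ hδ, funext fun ω => map_mul _ _ _⟩
  · rintro _ ⟨γ, -, rfl⟩
    exact continuous_pi fun ω => (continuous_end_mul_left
      (continuous_const_smul (γ ω))).comp (continuous_apply ω)

/-- For an idempotent `w`, the element equal to `1` at `(1, …, 1)` and to `w` elsewhere is a
product of elements carried by lower hyperfaces. -/
theorem lower_mem_cubeEllis {n : ℕ} {w : Function.End X} (hw : w ∈ ellis G X) (hww : w * w = w) :
    (fun ω => if ω = (fun _ => true) then 1 else w) ∈ cubeEllis G X n := by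
  -- Multiply over the coordinates in s; idempotence of w absorbs overlaps of hyperfaces.
  have key : ∀ s : Finset (Fin n),
      (fun ω => if ∃ i ∈ s, ω i = false then w else 1) ∈ cubeEllis G X n := by
    intro s
    induction s using Finset.induction_on with
    | empty => simpa [← Pi.one_def] using one_mem_cubeEllis (G := G) (X := X) n
    | insert i s _ ih =>
      convert mul_mem_cubeEllis (hyperface_mem_cubeEllis i hw) ih using 1
      funext ω
      by_cases h1 : ω i = false <;> by_cases h2 : ∃ j ∈ s, ω j = false <;>
        simp [h1, h2, hww]
  convert key Finset.univ using 1
  funext ω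
  by_cases h : ω = fun _ => true
  · simp [h]
  · have h' : ∃ i, ω i = false := by
      by_contra hc
      push Not at hc
      exact h (funext fun i => by simpa using hc i)
    simp [h, h']

/-- The enveloping semigroup preserves the dynamical cubes. -/
theorem cubeEllis_apply_mem {n : ℕ} {φ : Cube n → Function.End X} (hφ : φ ∈ cubeEllis G X n)
    {c : Cube n → X} (hc : c ∈ dynamicalCubes G X n) :
    (fun ω => φ ω (c ω)) ∈ dynamicalCubes G X n := by
  have h1 : MapsTo (fun (φ : Cube n → Function.End X) (ω : Cube n) => φ ω (c ω))
      ((fun γ ω => (MulAction.toEndHom (γ ω) : Function.End X)) ''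
        (hostKraGroup G n : Set (Cube n → G))) (dynamicalCubes G X n) := by
    rintro _ ⟨γ, hγ, rfl⟩
    refine MapsTo.closure (f := fun (c : Cube n → X) (ω : Cube n) => γ ω • c ω) ?_
      (by fun_prop) hc
    rintro _ ⟨δ, hδ, x, rfl⟩
    exact ⟨γ * δ, mul_mem hγ hδ, x, funext fun ω => by simp [mul_smul]⟩
  have h2 := h1.closure (continuous_pi fun ω =>
    (continuous_end_apply (c ω)).comp (continuous_apply ω)) hφ
  rwa [dynamicalCubes, closure_closure] at h2

end Mul

theorem const_mem_dynamicalCubes (n : ℕ) (x : X) : (fun _ => x) ∈ dynamicalCubes G X n :=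
  subset_closure ⟨1, one_mem _, x, by simp⟩

/-- The dynamical cubes are invariant under reflections of the discrete cube. -/
theorem reflect_mem_dynamicalCubes {n : ℕ} (v : Cube n) {c : Cube n → X}
    (hc : c ∈ dynamicalCubes G X n) :
    (fun ω => c (fun i => ω i == v i)) ∈ dynamicalCubes G X n := by
  refine MapsTo.closure (f := fun (c : Cube n → X) (ω : Cube n) => c fun i => ω i == v i) ?_
    (by fun_prop) hc
  rintro _ ⟨γ, hγ, x, rfl⟩
  refine ⟨fun ω => γ fun i => ω i == v i, ?_, x, rfl⟩
  let f : (Cube n → G) →* (Cube n → G) :=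
    { toFun := fun γ ω => γ fun i => ω i == v i
      map_one' := rfl
      map_mul' := fun _ _ => rfl }
  suffices h : hostKraGroup G n ≤ (hostKraGroup G n).comap f from h hγ
  refine (Subgroup.closure_le _).2 ?_
  rintro _ ⟨i, a, h, rfl⟩
  refine Subgroup.subset_closure ⟨i, a == v i, h, ?_⟩
  funext ω
  have : (ω i == v i) = a ↔ ω i = (a == v i) := by
    cases ω i <;> cases v i <;> cases a <;> simp
  by_cases hω : ω i = (a == v i) <;> simp [f, faceElement, hyperface, this, hω]

/-! ### Idempotents and relative inverses in minimal systems -/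

section Minimal

variable {G X : Type*} [Group G] [TopologicalSpace X] [CompactSpace X] [T2Space X] [MulAction G X]

/-- In a minimal system every point is fixed by an idempotent of a given minimal left ideal. -/
theorem IsMinimalLeftIdeal.exists_idempotent_fixing [MulAction.IsMinimal G X]
    {I : Set (Function.End X)} (hI : IsMinimalLeftIdeal (ellis G X) I) (x : X) :
    ∃ w ∈ I, w * w = w ∧ w x = x := by
  have hcomp : IsCompact I := hI.isClosed.isCompact
  have hx : ∃ p ∈ I, p x = x := by
    obtain ⟨q, hq⟩ := hI.nonempty
    have hcl : IsClosed ((fun p : Function.End X => p x) '' I) :=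
      (hcomp.image (continuous_end_apply x)).isClosed
    have hsub : MulAction.orbit G (q x) ⊆ (fun p : Function.End X => p x) '' I := by
      rintro _ ⟨g, rfl⟩
      exact ⟨_, hI.mul_mem _ (toEndHom_mem_ellis g) q hq, rfl⟩
    exact closure_minimal hsub hcl (MulAction.dense_orbit G (q x) x)
  -- The elements of I fixing x form a nonempty compact semigroup, so Ellis's theorem gives an
  -- idempotent.
  obtain ⟨w, ⟨hw, hwx⟩, hww⟩ := exists_idempotent_in_compact_subsemigroup
    continuous_end_mul_right (I ∩ {p | p x = x}) hx
    (hI.isClosed.inter (isClosed_singleton.preimage (continuous_end_apply x))).isCompact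
    (by
      rintro p ⟨hp, hpx⟩ q ⟨hq, hqx⟩
      refine ⟨hI.mul_mem p (hI.subset hp) q hq, ?_⟩
      change p (q x) = x
      rw [show q x = x from hqx, show p x = x from hpx])
  exact ⟨w, hw, hww, hwx⟩

theorem exists_ellis_apply_eq [MulAction.IsMinimal G X] (x y : X) : ∃ p ∈ ellis G X, p x = y := by
  have hcl : IsClosed ((fun p : Function.End X => p x) '' ellis G X) :=
    (isClosed_closure.isCompact.image (continuous_end_apply x)).isClosed
  refine closure_minimal ?_ hcl (MulAction.dense_orbit G x y)
  rintro _ ⟨g, rfl⟩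
  exact ⟨_, toEndHom_mem_ellis g, rfl⟩

variable [ContinuousConstSMul G X]

/-- The dynamical cubes are the orbit of any constant configuration under the enveloping
semigroup. -/
theorem exists_cubeEllis_apply_eq [MulAction.IsMinimal G X] {n : ℕ} (x : X)
    {c : Cube (n + 1) → X} (hc : c ∈ dynamicalCubes G X (n + 1)) :
    ∃ t ∈ cubeEllis G X (n + 1), (fun ω => t ω x) = c := by
  have hcl : IsClosed ((fun (t : Cube (n + 1) → Function.End X) ω => t ω x) ''
      cubeEllis G X (n + 1)) :=
    (isClosed_closure.isCompact.image (continuous_pi fun ω =>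
      (continuous_end_apply x).comp (continuous_apply ω))).isClosed
  refine closure_minimal ?_ hcl hc
  rintro _ ⟨γ, hγ, z, rfl⟩
  obtain ⟨p, hp, rfl⟩ := exists_ellis_apply_eq (G := G) x z
  exact ⟨_, mul_mem_cubeEllis (toEndHom_mem_cubeEllis hγ) (const_mem_cubeEllis hp), rfl⟩

variable {I : Set (Function.End X)}

theorem IsMinimalLeftIdeal.mul_eq_of_idempotent (hI : IsMinimalLeftIdeal (ellis G X) I)
    {p v : Function.End X} (hp : p ∈ I) (hv : v ∈ I) (hvv : v * v = v) : p * v = p :=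
  hI.mul_idempotent isClosed_closure (fun _ ha _ hb => mul_mem_ellis ha hb)
    continuous_end_mul_right hp hv hvv

/-- For an idempotent `w` of a minimal left ideal, the elements `wtw` are invertible relative
to `w`. -/
theorem IsMinimalLeftIdeal.exists_inverse (hI : IsMinimalLeftIdeal (ellis G X) I)
    {w : Function.End X} (hw : w ∈ I) (hww : w * w = w) {n : ℕ}
    {t : Cube (n + 1) → Function.End X} (ht : t ∈ cubeEllis G X (n + 1)) :
    ∃ s ∈ cubeEllis G X (n + 1), ∀ ω, s ω * (w * t ω * w) = w ∧ (w * t ω * w) * s ω = w := by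
  set W : Cube (n + 1) → Function.End X := fun _ => w with hW
  have hWE : W ∈ cubeEllis G X (n + 1) := const_mem_cubeEllis (hI.subset hw)
  set T := W * t * W with hT
  have hTE : T ∈ cubeEllis G X (n + 1) := mul_mem_cubeEllis (mul_mem_cubeEllis hWE ht) hWE
  have hWW : W * W = W := funext fun _ => hww
  have hTW : T * W = T := by rw [hT, mul_assoc, hWW]
  have hWT : W * T = T := by rw [hT, ← mul_assoc, ← mul_assoc, hWW]
  -- Idempotents with coordinates in `I` are right identities on `W`.
  have hid : ∀ e ∈ cubeEllis G X (n + 1), (∀ ω, e ω ∈ I) → e * e = e → W * e = W :=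
    fun e _ heI hee => funext fun ω =>
      hI.mul_eq_of_idempotent hw (heI ω) (congrFun hee ω)
  have hmemI : ∀ e ∈ cubeEllis G X (n + 1), ∀ ω, (e * W) ω ∈ I := fun e he ω =>
    hI.mul_mem _ (apply_mem_ellis he ω) w hw
  -- An idempotent eT of the compact left ideal generated by T has coordinates in I because TW = T;
  -- then WeW is a left inverse of T.
  obtain ⟨_, ⟨e, he, rfl⟩, hv⟩ := exists_idempotent_in_compact_subsemigroup
    continuous_pi_end_mul_right ((· * T) '' cubeEllis G X (n + 1)) ⟨_, T, hTE, rfl⟩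
    (isClosed_closure.isCompact.image (continuous_pi_end_mul_right T)) (by
      rintro _ ⟨a, ha, rfl⟩ _ ⟨b, hb, rfl⟩
      exact ⟨a * T * b, mul_mem_cubeEllis (mul_mem_cubeEllis ha hTE) hb, by
        simp only [mul_assoc]⟩)
  have h1 : W * (e * T) = W := hid _ (mul_mem_cubeEllis he hTE)
    (by rw [← hTW, ← mul_assoc]; exact hmemI _ (mul_mem_cubeEllis he hTE)) hv
  set s := W * e * W with hs
  have hsE : s ∈ cubeEllis G X (n + 1) := mul_mem_cubeEllis (mul_mem_cubeEllis hWE he) hWE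
  have hsW : s * W = s := by rw [hs, mul_assoc, hWW]
  have hsT : s * T = W := by rw [hs, mul_assoc, hWT, mul_assoc, h1]
  -- Ts is an idempotent with coordinates in I, hence W(Ts) = W, while WT = T gives W(Ts) = Ts.
  have hTs : T * s = W := by
    have h2 : W * (T * s) = T * s := by rw [← mul_assoc, hWT]
    rw [← h2]
    refine hid _ (mul_mem_cubeEllis hTE hsE) ?_ ?_
    · rw [← hsW, ← mul_assoc]
      exact hmemI _ (mul_mem_cubeEllis hTE hsE)
    · rw [mul_assoc, ← mul_assoc s, hsT, ← mul_assoc, hTW]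
  exact ⟨s, hsE, fun ω => ⟨congrFun hsT ω, congrFun hTs ω⟩⟩

end Minimal

/-! ### Vertex replacement and the equivalence relation -/

section Relation

variable {G X : Type*} [Group G] [TopologicalSpace X] [MulAction G X]

theorem NRP.refl (d : ℕ) (x : X) : NRP G X d x x := by
  have h : lowerCorner (d + 1) x x = fun _ => x := by
    funext ω
    simp [lowerCorner]
  unfold NRP
  rw [h]
  exact const_mem_dynamicalCubes _ _

/-- `NRP^{[d]}` may be tested at any vertex of the cube. -/
theorem NRP.update_const_mem {d : ℕ} {x y : X} (h : NRP G X d x y) (v : Cube (d + 1)) :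
    update (fun _ => x) v y ∈ dynamicalCubes G X (d + 1) := by
  convert reflect_mem_dynamicalCubes v h using 1
  funext ω
  have : ω = v ↔ (fun i => ω i == v i) = fun _ => true := by
    simp [funext_iff]
  by_cases hω : ω = v <;> simp [lowerCorner, ← this, hω]

theorem NRP.ellis_apply [ContinuousConstSMul G X] {d : ℕ} {x y : X} (h : NRP G X d x y)
    {p : Function.End X} (hp : p ∈ ellis G X) : NRP G X d (p x) (p y) := by
  have h1 := cubeEllis_apply_mem (const_mem_cubeEllis hp) h
  unfold NRP
  convert h1 using 1
  funext ω
  by_cases hω : ω = fun _ => true <;> simp [lowerCorner, hω]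

theorem isClosed_NRP (d : ℕ) : IsClosed {q : X × X | NRP G X d q.1 q.2} := by
  refine isClosed_closure.preimage (f := fun q : X × X => lowerCorner (d + 1) q.1 q.2) ?_
  refine continuous_pi fun ω => ?_
  unfold lowerCorner
  split_ifs
  exacts [continuous_snd, continuous_fst]

variable (G X) in
theorem exists_isMinimalLeftIdeal_ellis [CompactSpace X] [ContinuousConstSMul G X] :
    ∃ I, IsMinimalLeftIdeal (ellis G X) I :=
  exists_isMinimalLeftIdeal isClosed_closure ⟨_, toEndHom_mem_ellis 1⟩
    fun _ ha _ hb => mul_mem_ellis ha hb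

variable [CompactSpace X] [T2Space X] [ContinuousConstSMul G X] [MulAction.IsMinimal G X]
  {I : Set (Function.End X)}

/-- A vertex of a dynamical cube may be replaced by a regionally proximal point if all points
involved are fixed by a common minimal idempotent. -/
theorem IsMinimalLeftIdeal.update_mem_dynamicalCubes (hI : IsMinimalLeftIdeal (ellis G X) I)
    {w : Function.End X} (hw : w ∈ I) (hww : w * w = w) {d : ℕ} {c : Cube (d + 1) → X}
    (hc : c ∈ dynamicalCubes G X (d + 1)) (hcw : ∀ ω, w (c ω) = c ω) (v : Cube (d + 1)) {y : X}
    (hy : w y = y) (h : NRP G X d (c v) y) :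
    update c v y ∈ dynamicalCubes G X (d + 1) := by
  have hwx : w (w y) = w y := congrFun hww y
  obtain ⟨t, ht, htc⟩ := exists_cubeEllis_apply_eq (G := G) y hc
  obtain ⟨s, hs, hst⟩ := hI.exists_inverse hw hww ht
  have hT : ∀ ω, (w * t ω * w) y = c ω := fun ω => by
    change w (t ω (w y)) = c ω
    rw [hy, congrFun htc ω, hcw]
  have hTE : (fun ω => w * t ω * w) ∈ cubeEllis G X (d + 1) :=
    mul_mem_cubeEllis (mul_mem_cubeEllis (const_mem_cubeEllis (hI.subset hw)) ht)
      (const_mem_cubeEllis (hI.subset hw))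
  have hsc : s v (c v) = y := by
    rw [← hT v]
    exact (congrFun (hst v).1 y).trans hy
  -- The coordinate of the inverse at v carries the pair (c v, y) to (y, s v y), based at the
  -- constant cube y.
  have h1 : NRP G X d y (s v y) := by
    simpa only [hsc] using h.ellis_apply (apply_mem_ellis hs v)
  convert cubeEllis_apply_mem hTE (h1.update_const_mem v) using 1
  funext ω
  by_cases hω : ω = v
  · subst hω
    simp only [update_self]
    exact ((congrFun (hst ω).2 y).trans hy).symm
  · simp only [update_of_ne hω]
    exact (hT ω).symm

/-- Replacement at all vertices of a set. -/
theorem IsMinimalLeftIdeal.piecewise_mem_dynamicalCubes (hI : IsMinimalLeftIdeal (ellis G X) I)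
    {w : Function.End X} (hw : w ∈ I) (hww : w * w = w) {d : ℕ} {c : Cube (d + 1) → X}
    (hc : c ∈ dynamicalCubes G X (d + 1)) (hcw : ∀ ω, w (c ω) = c ω) {y : X} (hy : w y = y)
    (s : Finset (Cube (d + 1))) (h : ∀ ω ∈ s, NRP G X d (c ω) y) :
    (fun ω => if ω ∈ s then y else c ω) ∈ dynamicalCubes G X (d + 1) := by
  induction s using Finset.induction_on with
  | empty => simpa using hc
  | insert v s hv ih =>
    have h1 := hI.update_mem_dynamicalCubes hw hww
      (ih fun ω hω => h ω (Finset.mem_insert_of_mem hω))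
      (fun ω => by split_ifs; exacts [hy, hcw ω]) v hy
      (by simpa [hv] using h v (Finset.mem_insert_self v s))
    convert h1 using 1
    funext ω
    by_cases hω : ω = v <;> simp [hω]

/-- Let v ∈ I be an idempotent fixing z. Act on the corner by v at the top vertex and wv elsewhere:
since vw = v and wv = w, this sends wz to z and fixes y. -/
theorem IsMinimalLeftIdeal.nrp_of_idempotent_apply (hI : IsMinimalLeftIdeal (ellis G X) I)
    {w : Function.End X} (hw : w ∈ I) (hww : w * w = w) {d : ℕ} {y z : X} (hy : w y = y)
    (h : NRP G X d y (w z)) : NRP G X d y z := by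
  obtain ⟨v, hv, hvv, hvz⟩ := hI.exists_idempotent_fixing z
  have hu := mul_mem_cubeEllis (lower_mem_cubeEllis (n := d + 1) (hI.subset hw) hww)
    (const_mem_cubeEllis (hI.subset hv))
  have h1 := cubeEllis_apply_mem hu h
  unfold NRP
  convert h1 using 1
  funext ω
  by_cases hω : ω = fun _ => true
  · simp only [lowerCorner, hω, if_true, Pi.mul_apply, one_mul]
    exact (hvz.symm.trans (congrFun (hI.mul_eq_of_idempotent hv hw hww) z).symm)
  · simp only [lowerCorner, hω, if_false, Pi.mul_apply, hI.mul_eq_of_idempotent hw hv hvv]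
    exact hy.symm

/-- With w fixing y, replace wx by y in the constant cube wx at every vertex except the top one,
then remove w. -/
theorem IsMinimalLeftIdeal.nrp_symm (hI : IsMinimalLeftIdeal (ellis G X) I) {d : ℕ} {x y : X}
    (h : NRP G X d x y) : NRP G X d y x := by
  obtain ⟨w, hw, hww, hy⟩ := hI.exists_idempotent_fixing y
  refine hI.nrp_of_idempotent_apply hw hww hy ?_
  have h1 : NRP G X d (w x) y := by simpa only [hy] using h.ellis_apply (hI.subset hw)
  have h2 := hI.piecewise_mem_dynamicalCubes hw hww (const_mem_dynamicalCubes (d + 1) (w x))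
    (fun _ => congrFun hww x) hy (Finset.univ.erase fun _ => true) (fun _ _ => h1)
  unfold NRP
  convert h2 using 1
  funext ω
  by_cases hω : ω = fun _ => true <;> simp [lowerCorner, hω]

/-- A dynamical cube whose values are regionally proximal to those of a lower corner witnesses
that the two values of the corner are regionally proximal. -/
theorem IsMinimalLeftIdeal.nrp_of_mem_dynamicalCubes (hI : IsMinimalLeftIdeal (ellis G X) I)
    {d : ℕ} {x y : X} {c : Cube (d + 1) → X} (hc : c ∈ dynamicalCubes G X (d + 1))
    (hcx : ∀ ω, ω ≠ (fun _ => true) → NRP G X d (c ω) x)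
    (hcy : NRP G X d (c fun _ => true) y) : NRP G X d x y := by
  obtain ⟨w, hw, hww, hx⟩ := hI.exists_idempotent_fixing x
  have hwE := hI.subset hw
  refine hI.nrp_of_idempotent_apply hw hww hx ?_
  have h1 := hI.piecewise_mem_dynamicalCubes hw hww
    (cubeEllis_apply_mem (const_mem_cubeEllis hwE) hc) (fun ω => congrFun hww (c ω)) hx
    (Finset.univ.erase fun _ => true)
    (fun ω hω => by simpa only [hx] using (hcx ω (Finset.ne_of_mem_erase hω)).ellis_apply hwE)
  have h2 := hI.update_mem_dynamicalCubes hw hww h1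
    (fun ω => by split_ifs; exacts [hx, congrFun hww (c ω)]) (fun _ => true)
    (congrFun hww y) (by simpa using hcy.ellis_apply hwE)
  unfold NRP
  convert h2 using 1
  funext ω
  by_cases hω : ω = fun _ => true <;> simp [lowerCorner, hω]

-- For transitivity, the corner of (x, y) is a cube agreeing with that of (x, z) except at the top,
-- where y is NRP-related to z.
variable (G X) in
theorem equivalence_NRP (d : ℕ) : Equivalence (NRP G X d) := by
  obtain ⟨I, hI⟩ := exists_isMinimalLeftIdeal_ellis G X
  refine ⟨NRP.refl d, hI.nrp_symm, fun {x y z} hxy hyz => ?_⟩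
  refine hI.nrp_of_mem_dynamicalCubes hxy (fun ω hω => ?_) ?_
  · simpa [lowerCorner, hω] using NRP.refl d x
  · simpa [lowerCorner] using hyz

end Relation

/-! ### Factor maps and quotients -/

section Factor

variable {G X Y : Type*} [Group G] [TopologicalSpace X] [MulAction G X] [TopologicalSpace Y]
  [MulAction G Y]

theorem IsFactorMap.comp_mem_dynamicalCubes {φ : X → Y} (hφ : IsFactorMap G φ) {n : ℕ}
    {c : Cube n → X} (hc : c ∈ dynamicalCubes G X n) : φ ∘ c ∈ dynamicalCubes G Y n := by
  refine MapsTo.closure (f := fun c : Cube n → X => φ ∘ c) ?_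
    (continuous_pi fun ω => hφ.continuous.comp (continuous_apply ω)) hc
  rintro _ ⟨γ, hγ, x, rfl⟩
  exact ⟨γ, hγ, φ x, funext fun ω => hφ.map_smul _ _⟩

theorem IsFactorMap.nrp {φ : X → Y} (hφ : IsFactorMap G φ) {d : ℕ} {x y : X}
    (h : NRP G X d x y) : NRP G Y d (φ x) (φ y) := by
  unfold NRP
  convert hφ.comp_mem_dynamicalCubes h using 1
  funext ω
  by_cases hω : ω = fun _ => true <;> simp [lowerCorner, hω]

/-- The image of the cubes of X is compact, hence closed, and contains the generating configurations
of Y. -/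
theorem IsFactorMap.exists_mem_dynamicalCubes [CompactSpace X] [T2Space Y] {φ : X → Y}
    (hφ : IsFactorMap G φ) {n : ℕ} {b : Cube n → Y} (hb : b ∈ dynamicalCubes G Y n) :
    ∃ c ∈ dynamicalCubes G X n, φ ∘ c = b := by
  have hcl : IsClosed ((fun c : Cube n → X => φ ∘ c) '' dynamicalCubes G X n) :=
    (isClosed_closure.isCompact.image
      (continuous_pi fun ω => hφ.continuous.comp (continuous_apply ω))).isClosed
  refine closure_minimal ?_ hcl hb
  rintro _ ⟨γ, hγ, y, rfl⟩
  obtain ⟨x, rfl⟩ := hφ.surjective y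
  exact ⟨_, subset_closure ⟨γ, hγ, x, rfl⟩, funext fun ω => hφ.map_smul _ _⟩

end Factor

/-- The quotient of a compact Hausdorff space by a closed equivalence relation is Hausdorff. -/
theorem t2Space_quotient_of_isClosed {X : Type*} [TopologicalSpace X] [CompactSpace X] [T2Space X]
    (r : Setoid X) (hr : IsClosed {q : X × X | r q.1 q.2}) : T2Space (Quotient r) := by
  have hclosed : IsClosedMap (Quotient.mk r) := by
    intro F hF
    rw [← isQuotientMap_quotient_mk'.isClosed_preimage]
    have h : Quotient.mk r ⁻¹' (Quotient.mk r '' F)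
        = Prod.snd '' ({q : X × X | r q.1 q.2} ∩ Prod.fst ⁻¹' F) := by
      ext y
      constructor
      · rintro ⟨x, hx, hxy⟩
        exact ⟨(x, y), ⟨Quotient.exact hxy, hx⟩, rfl⟩
      · rintro ⟨⟨x, _⟩, ⟨hxy, hx⟩, rfl⟩
        exact ⟨x, hx, Quotient.sound hxy⟩
    change IsClosed (Quotient.mk r ⁻¹' (Quotient.mk r '' F))
    rw [h]
    exact ((hr.inter (hF.preimage continuous_fst)).isCompact.image continuous_snd).isClosed
  have hfib : ∀ a : Quotient r, IsClosed (Quotient.mk r ⁻¹' {a}) := by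
    intro a
    obtain ⟨x, rfl⟩ := Quotient.exists_rep a
    refine IsClosed.preimage continuous_quotient_mk' ?_
    simpa using hclosed {x} isClosed_singleton
  refine ⟨fun a b hab => ?_⟩
  obtain ⟨U, V, hU, hV, haU, hbV, hUV⟩ := normal_separation (hfib a) (hfib b)
    (Disjoint.preimage _ (by simpa using hab))
  -- These are the classes contained entirely in U, respectively V; they are open because the
  -- quotient map is closed.
  refine ⟨(Quotient.mk r '' Uᶜ)ᶜ, (Quotient.mk r '' Vᶜ)ᶜ, (hclosed _ hU.isClosed_compl).isOpen_compl,
    (hclosed _ hV.isClosed_compl).isOpen_compl, ?_, ?_, ?_⟩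
  · rintro ⟨x, hx, hxa⟩
    exact hx (haU hxa)
  · rintro ⟨x, hx, hxb⟩
    exact hx (hbV hxb)
  · rw [Set.disjoint_left]
    intro q hqU hqV
    obtain ⟨x, rfl⟩ := Quotient.exists_rep q
    have h1 : x ∈ U := by
      by_contra hx
      exact hqU ⟨x, hx, rfl⟩
    have h2 : x ∈ V := by
      by_contra hx
      exact hqV ⟨x, hx, rfl⟩
    exact Set.disjoint_left.1 hUV h1 h2

/-- An action for which a continuous equivariant surjection from a compact system exists is
continuous. -/
theorem IsFactorMap.continuousSMul {G X Y : Type*} [Group G] [TopologicalSpace G]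
    [TopologicalSpace X] [CompactSpace X] [MulAction G X] [ContinuousSMul G X]
    [TopologicalSpace Y] [T2Space Y] [MulAction G Y] {φ : X → Y} (hφ : IsFactorMap G φ) :
    ContinuousSMul G Y := by
  -- A product of quotient maps need not be a quotient map; here properness of φ makes the product
  -- closed, whatever G is.
  have hq : Topology.IsQuotientMap (Prod.map (id : G → G) φ) :=
    (isProperMap_id.prodMap hφ.continuous.isProperMap).isClosedMap.isQuotientMap
      (continuous_id.prodMap hφ.continuous) (surjective_id.prodMap hφ.surjective)
  refine ⟨hq.continuous_iff.2 ?_⟩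
  have h : (fun p : G × Y => p.1 • p.2) ∘ Prod.map (id : G → G) φ
      = fun p : G × X => φ (p.1 • p.2) := by
    funext p
    exact (hφ.map_smul _ _).symm
  rw [h]
  exact hφ.continuous.comp continuous_smul

theorem NRPQuotient.isFactorMap_mk {G X : Type*} [Group G] [TopologicalSpace X] [MulAction G X]
    [ContinuousConstSMul G X] {d : ℕ} (h : Equivalence (NRP G X d)) :
    IsFactorMap G (NRPQuotient.mk h) :=
  ⟨continuous_quotient_mk', fun _ _ => rfl, Quotient.exists_rep⟩

end NilRP

theorem mainTheorem5 {G : Type*} {X : Type*}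
    [Group G] [TopologicalSpace G] [IsTopologicalGroup G] [T2Space G]
    [TopologicalSpace X] [CompactSpace X] [T2Space X]
    [MulAction G X] [ContinuousSMul G X] [MulAction.IsMinimal G X]
    (d : ℕ) (hd : 1 ≤ d) :
    ∃ h : Equivalence (NilRP.NRP G X d),
      CompactSpace (NilRP.NRPQuotient h) ∧
      T2Space (NilRP.NRPQuotient h) ∧
      ContinuousSMul G (NilRP.NRPQuotient h) ∧
      NilRP.IsFactorMap G (NilRP.NRPQuotient.mk h) ∧
      NilRP.IsOfOrderAtMost G (NilRP.NRPQuotient h) d ∧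
      ∀ (Y : Type*) [TopologicalSpace Y] [CompactSpace Y] [T2Space Y]
        [MulAction G Y] [ContinuousSMul G Y] (φ : X → Y),
        NilRP.IsFactorMap G φ → NilRP.IsOfOrderAtMost G Y d →
          ∃ ψ : NilRP.NRPQuotient h → Y,
            NilRP.IsFactorMap G ψ ∧ φ = ψ ∘ NilRP.NRPQuotient.mk h := by
  have h := NilRP.equivalence_NRP G X d
  have hπ := NilRP.NRPQuotient.isFactorMap_mk h
  have hT2 : T2Space (NilRP.NRPQuotient h) :=
    NilRP.t2Space_quotient_of_isClosed (Setoid.mk _ h) (NilRP.isClosed_NRP d)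
  refine ⟨h, Quotient.compactSpace (s := Setoid.mk _ h), hT2, hπ.continuousSMul, hπ, ?_, ?_⟩
  · intro a b
    refine ⟨fun hab => ?_, fun hab => hab ▸ NilRP.NRP.refl d a⟩
    obtain ⟨x, rfl⟩ := hπ.surjective a
    obtain ⟨y, rfl⟩ := hπ.surjective b
    -- The lifted cube need not be a corner, but its values are NRP-related to those of the corner
    -- of (x, y).
    obtain ⟨c, hc, hcb⟩ := hπ.exists_mem_dynamicalCubes hab
    obtain ⟨I, hI⟩ := NilRP.exists_isMinimalLeftIdeal_ellis G X
    refine Quotient.sound (s := Setoid.mk _ h)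
      (hI.nrp_of_mem_dynamicalCubes hc (fun ω hω => ?_) ?_)
    · refine Quotient.exact (s := Setoid.mk _ h) ((congrFun hcb ω).trans ?_)
      simp only [NilRP.lowerCorner, hω, if_false]
      rfl
    · refine Quotient.exact (s := Setoid.mk _ h) ((congrFun hcb _).trans ?_)
      simp only [NilRP.lowerCorner, if_true]
      rfl
  · intro Y _ _ _ _ _ φ hφ hY
    have hresp : ∀ x y, NilRP.NRP G X d x y → φ x = φ y := fun x y hxy =>
      (hY _ _).1 (hφ.nrp hxy)
    refine ⟨Quotient.lift (s := Setoid.mk _ h) φ hresp, ⟨?_, ?_, ?_⟩, rfl⟩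
    · exact hφ.continuous.quotient_lift (s := Setoid.mk _ h) hresp
    · rintro g ⟨x⟩
      exact hφ.map_smul g x
    · intro y
      obtain ⟨x, rfl⟩ := hφ.surjective y
      exact ⟨NilRP.NRPQuotient.mk h x, rfl⟩
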